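/- Let $\mathsf X$ be a measurable space with a $\sigma$-finite reference measure $\mathrm{d}y$ (e.g. Lebesgue measure or the counting measure on a countable set), let $\pi$ be a probability density on $\mathsf X$ (also write $\pi$ for the corresponding probability measure), and let $q(x,\cdot)$, $x\in\mathsf X$, be probability densities, $q$ being jointly measurable. Put $$r(x,y)=\frac{\pi(y)q(y,x)}{\pi(x)q(x,y)}$$ (with $r(x,y)=0$ where the denominator vanishes). For a function $a:\mathsf X^2\to[0,1]$ put $$\Pi_a(x,A)=\int_A q(x,y)a(x,y)\,\mathrm{d}y+\Bigl(1-\int_{\mathsf X}q(x,y)a(x,y)\,\mathrm{d}y\Bigr)\mathbf 1_A(x),$$ and let $P=\Pi_\alpha$ with $\alpha(x,y)=\min\{1,r(x,y)\}$ be the Metropolis--Hastings kernel. Let $d\ge 2$ and let $\tilde\rho_1,\dots,\tilde\rho_d$ be measurable real functions on $\mathsf X^2$ such that, for all $(x,y)$ with $\pi(x)q(x,y)>0$ and $\pi(y)q(y,x)>0$, $$\tilde\rho_k(x,y)>0,\qquad \tilde\rho_k(x,y)=\tilde\rho_k(y,x)^{-1}\quad(1\le k\le d),\qquad r(x,y)=\prod_{k=1}^d\tilde\rho_k(x,y).$$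 Let $c\in(0,1]$, $b=c^{1/(d-1)}$, and $$\rho_k=\min\{1/b,\max\{b,\tilde\rho_k\}\}\quad(1\le k\le d-1),\qquad \rho_d=\frac{r}{\prod_{k=1}^{d-1}\rho_k}.$$ Let $\tilde P=\Pi_{\tilde\alpha}$ with $\tilde\alpha(x,y)=\prod_{k=1}^d\min\{1,\rho_k(x,y)\}$ be the associated Delayed Acceptance kernel. For a $\pi$-reversible Markov kernel $\Pi$ and $f\in L^2(\pi)$ let $$\mathcal E_\Pi(f)=\frac12\int\pi(\mathrm{d}x)\Pi(x,\mathrm{d}y)[f(x)-f(y)]^2,$$ let $L^2_0(\pi)=\{f\in L^2(\pi):\pi(f)=0\}$, let $$\mathrm{Gap}(\Pi)=\inf\Bigl\{\frac{\mathcal E_\Pi(f)}{\langle f,f\rangle_\pi}: f\in L^2_0(\pi),\ f\neq0\Bigr\}\in[0,\infty]$$ ($\infty$ if $L_0^2(\pi)=\{0\}$), and let $$\mathrm{var}(f,\Pi)=\lim_{n\to\infty}\mathrm{var}\Bigl(n^{-1/2}\sum_{i=1}^n[f(X_i)-\pi(f)]\Bigr)\in[0,\infty],$$ where $(X_n)_{n\ge1}$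 is a Markov chain with kernel $\Pi$ and $X_1\sim\pi$. Then $P$ and $\tilde P$ are $\pi$-reversible Markov kernels and, with $\varrho=c^2$ (independently of $d$): 1. $\mathcal E_{\tilde P}(f)\ge\varrho\,\mathcal E_P(f)$ for all $f\in L^2_0(\pi)$; 2. $\mathrm{Gap}(\tilde P)\ge\varrho\,\mathrm{Gap}(P)$; 3. for all $f\in L^2_0(\pi)$ the limits defining $\mathrm{var}(f,P)$ and $\mathrm{var}(f,\tilde P)$ exist in $[0,\infty]$ and $$\mathrm{var}(f,\tilde P)\le(\varrho^{-1}-1)\,\mathrm{var}_\pi(f)+\varrho^{-1}\,\mathrm{var}(f,P).$$ -/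

import Mathlib

open MeasureTheory ProbabilityTheory Filter Topology
open scoped ENNReal

noncomputable section

namespace DelayedAcceptance

variable {X : Type*} [MeasurableSpace X]

/-- `p` is (a version of) a probability density with respect to `lam`. -/
structure IsTargetDensity (lam : Measure X) (p : X → ℝ) : Prop where
  measurable : Measurable p
  nonneg : ∀ x, 0 ≤ p x
  lintegral_eq_one : ∫⁻ x, ENNReal.ofReal (p x) ∂lam = 1

/-- `q x` is, for every `x`, a probability density with respect to `lam`, jointly measurably
in both variables. -/
structure IsProposalDensity (lam : Measure X) (q : X → X → ℝ) : Prop where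
  measurable : Measurable (Function.uncurry q)
  nonneg : ∀ x y, 0 ≤ q x y
  lintegral_eq_one : ∀ x, ∫⁻ y, ENNReal.ofReal (q x y) ∂lam = 1

/-- The target distribution, with density `p` with respect to `lam`. -/
def target (lam : Measure X) (p : X → ℝ) : Measure X :=
  lam.withDensity fun x => ENNReal.ofReal (p x)

/-- The Metropolis-Hastings ratio `r(x,y) = p(y) q(y,x) / (p(x) q(x,y))`. It is read as `0` where
`p(x) q(x,y) = 0`; such proposed moves have probability zero when `x` is distributed according to
the target, so that this convention is immaterial. -/
def ratio (p : X → ℝ) (q : X → X → ℝ) (x y : X) : ℝ :=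
  (p y * q y x) / (p x * q x y)

/-- `r = ∏ ρ k` with measurable positive factors satisfying the balance condition
`ρ k (x,y) = ρ k (y,x)⁻¹`. The pointwise conditions are only imposed where `r(x,y)` and `r(y,x)`
are both well defined and positive; elsewhere they could not hold with real positive factors. -/
structure IsBalancedFactorisation (p : X → ℝ) (q : X → X → ℝ) {d : ℕ}
    (rho : Fin d → X → X → ℝ) : Prop where
  measurable : ∀ k, Measurable (Function.uncurry (rho k))
  pos : ∀ k x y, 0 < p x * q x y → 0 < p y * q y x → 0 < rho k x y
  balance : ∀ k x y, 0 < p x * q x y → 0 < p y * q y x → rho k x y = (rho k y x)⁻¹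
  prod_eq : ∀ x y, 0 < p x * q x y → 0 < p y * q y x → ratio p q x y = ∏ k, rho k x y

/-- The Metropolis-Hastings acceptance probability `1 ∧ r(x,y)`. -/
def mhAccept (p : X → ℝ) (q : X → X → ℝ) (x y : X) : ℝ :=
  min 1 (ratio p q x y)

/-- The delayed acceptance probability `∏ (1 ∧ ρ k (x,y))`. -/
def daAccept {d : ℕ} (rho : Fin d → X → X → ℝ) (x y : X) : ℝ :=
  ∏ k, min 1 (rho k x y)

/-- The threshold `b = c ^ (1 / (d - 1))`. -/
def threshold (c : ℝ) (d : ℕ) : ℝ := c ^ (1 / ((d : ℝ) - 1))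

/-- Clipping of a real number to the interval `[b, 1/b]`. -/
def clip (b t : ℝ) : ℝ := min (1 / b) (max b t)

/-- The modified factors: the first `d - 1` factors are clipped to `[b, 1/b]`, and the last one
(the factor with index `d - 1`, indices starting at `0`) is `r` divided by the product of the
clipped ones. -/
def modifiedFactor (p : X → ℝ) (q : X → X → ℝ) (c : ℝ) {d : ℕ} (rho : Fin d → X → X → ℝ)
    (k : Fin d) (x y : X) : ℝ :=
  if (k : ℕ) < d - 1 then clip (threshold c d) (rho k x y)
  else ratio p q x y /
    ∏ j ∈ Finset.univ.filter (fun j : Fin d => (j : ℕ) < d - 1),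
      clip (threshold c d) (rho j x y)

/-- The kernel that proposes from `q x` and accepts the proposed point `y` with probability
`a x y`:
`Π(x,A) = ∫_A q(x,y) a(x,y) dy + (1 - ∫ q(x,y) a(x,y) dy) 1_A(x)`,
see `proposalKernel_apply`. -/
def proposalKernel (lam : Measure X) [SigmaFinite lam] (q a : X → X → ℝ) : Kernel X X :=
  Kernel.withDensity (Kernel.const X lam) (fun x y => ENNReal.ofReal (q x y * a x y)) +
    Kernel.withDensity Kernel.id
      (fun x _ => 1 - ∫⁻ y, ENNReal.ofReal (q x y * a x y) ∂lam)

theorem proposalKernel_apply (lam : Measure X) [SigmaFinite lam] {q a : X → X → ℝ}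
    (hq : Measurable (Function.uncurry q)) (ha : Measurable (Function.uncurry a))
    (x : X) {A : Set X} (hA : MeasurableSet A) :
    proposalKernel lam q a x A =
      ∫⁻ y in A, ENNReal.ofReal (q x y * a x y) ∂lam +
        (1 - ∫⁻ y, ENNReal.ofReal (q x y * a x y) ∂lam) * A.indicator 1 x := by
  have h1 : Measurable (Function.uncurry fun x y => ENNReal.ofReal (q x y * a x y)) :=
    (hq.mul ha).ennreal_ofReal
  have h2 : Measurable (Function.uncurry fun (x : X) (_ : X) =>
      1 - ∫⁻ y, ENNReal.ofReal (q x y * a x y) ∂lam) :=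
    (measurable_const.sub h1.lintegral_prod_right).comp measurable_fst
  rw [proposalKernel, _root_.add_apply, Measure.add_apply, Kernel.withDensity_apply' _ h1,
    Kernel.withDensity_apply' _ h2, Kernel.const_apply, lintegral_const,
    Measure.restrict_apply_univ, Kernel.id_apply, Measure.dirac_apply' _ hA]

/-- The Metropolis-Hastings kernel. -/
def mhKernel (lam : Measure X) [SigmaFinite lam] (p : X → ℝ) (q : X → X → ℝ) : Kernel X X :=
  proposalKernel lam q (mhAccept p q)

/-- The delayed acceptance kernel with factors `rho`. -/
def daKernel (lam : Measure X) [SigmaFinite lam] (q : X → X → ℝ) {d : ℕ}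
    (rho : Fin d → X → X → ℝ) : Kernel X X :=
  proposalKernel lam q (daAccept rho)

/-- The space `L²₀(μ)` of centred square integrable functions. -/
def IsCenteredL2 (mu : Measure X) (f : X → ℝ) : Prop :=
  MemLp f 2 mu ∧ ∫ x, f x ∂mu = 0

/-- The squared norm `⟨f, f⟩` in `L²(μ)`. -/
def sqNorm (mu : Measure X) (f : X → ℝ) : ℝ≥0∞ :=
  ∫⁻ x, ENNReal.ofReal (f x ^ 2) ∂mu

/-- The Dirichlet form `½ ∫ μ(dx) Π(x,dy) (f(x) - f(y))²`. -/
def dirichletForm (K : Kernel X X) (mu : Measure X) (f : X → ℝ) : ℝ≥0∞ :=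
  2⁻¹ * ∫⁻ x, ∫⁻ y, ENNReal.ofReal ((f x - f y) ^ 2) ∂(K x) ∂mu

/-- The right spectral gap: the infimum of `E(f) / ⟨f, f⟩` over nonzero `f` in `L²₀(μ)`
(`∞` if there is no such `f`). -/
def spectralGap (K : Kernel X X) (mu : Measure X) : ℝ≥0∞ :=
  ⨅ (f : X → ℝ) (_ : IsCenteredL2 mu f) (_ : sqNorm mu f ≠ 0),
    dirichletForm K mu f / sqNorm mu f

/-- The law on `ℕ → X` of the Markov chain with transition kernel `K` and initial law `mu`. -/
def chainLaw (K : Kernel X X) [IsMarkovKernel K] (mu : Measure X) : Measure (ℕ → X) :=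
  Kernel.trajMeasure (X := fun _ : ℕ => X) mu
    (fun n => K.comap (fun h : (∀ _ : Finset.Iic n, X) => h ⟨n, by simp⟩)
      (measurable_pi_apply _))

/-- `v = lim var (n^{-1/2} ∑_{i=1}^n [f(X_i) - μ(f)])`, the limit being taken in `[0, ∞]`, for the
Markov chain with kernel `K` started from `mu`. (The times are numbered from `0`.) -/
def HasAsymptoticVariance (K : Kernel X X) [IsMarkovKernel K] (mu : Measure X) (f : X → ℝ)
    (v : ℝ≥0∞) : Prop :=
  Tendsto
    (fun n : ℕ => evariance
      (fun w : ℕ → X => (n : ℝ) ^ (-(1 / 2) : ℝ) *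
        ∑ i ∈ Finset.range n, (f (w i) - ∫ x, f x ∂mu))
      (chainLaw K mu))
    atTop (𝓝 v)

end DelayedAcceptance

end

/-!
The delayed acceptance probability dominates `c²` times the Metropolis-Hastings one
(`sq_mul_mhAccept_le_daAccept`): each of the `d - 1` clipped stages accepts with probability at
least `b`, where `b ^ (d - 1) = c`, and the last factor is at least `c r`. Clipping at `b` and `1 / b`
preserves the balance condition, so both kernels satisfy detailed balance. Rejected moves do not
contribute to a Dirichlet form, hence the Dirichlet forms, and with them the spectral gaps, are
ordered in the same way.

For the asymptotic variances, let `A` be the operator of a reversible kernel on `L²(μ)`, a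
self-adjoint contraction (`transitionOp`). By the Markov property the autocovariances of the
stationary chain are `a k = ⟨f, Aᵏ f⟩`, so that the normalised variance is a Cesàro mean of the sums
`∑_{|k| ≤ n} a |k|`. No spectral theorem is needed to see that these means converge: the
sums differ by a bounded error, which vanishes on average if the series converges, from partial sums
of the series `∑ ‖(1 + A) Aⁱ f‖²` of nonnegative terms, and so the asymptotic variance is the value
of this series (`operatorVariance`).

This series is also `2 sup_h (2 ⟨f, h⟩ - ⟨h, (1 - A) h⟩) - ‖f‖²`. Of this formula one needs an upper
bound of the partial sums by an explicit `h` (`IsSymmContraction.le_functional_approxMax`) and a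
bound valid for all `h` (`IsSymmContraction.functional_le`). Since `⟨h, (1 - A) h⟩` is the Dirichlet
form of `h`, replacing `h` by `c² h` turns the ordering of the Dirichlet forms into the claimed
inequality (`operatorVariance_le`).
-/

noncomputable section

namespace DelayedAcceptance

/-! ### Symmetric contractions of a Hilbert space -/

section Hilbert

open scoped InnerProductSpace

variable {H : Type*} [NormedAddCommGroup H] [InnerProductSpace ℝ H]

/-- `A` is a symmetric contraction. -/
structure IsSymmContraction (A : H →L[ℝ] H) : Prop where
  symm : ∀ x y, ⟪A x, y⟫_ℝ = ⟪x, A y⟫_ℝ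
  norm_le : ∀ x, ‖A x‖ ≤ ‖x‖

/-- The spectral asymptotic variance `⟨f, (1 + A) (1 - A)⁻¹ f⟩`, in `[0, ∞]`, of a symmetric
contraction `A`. It is written as `∑ ‖(1 + A) Aⁱ f‖²`, which makes sense without a spectral measure:
for real `t` in `(-1, 1)` one has `(1 + t) / (1 - t) = ∑ (1 + t)² t²ⁱ`. -/
def operatorVariance (A : H →L[ℝ] H) (f : H) : ℝ≥0∞ :=
  ∑' i : ℕ, ENNReal.ofReal (‖(A ^ i) f + (A ^ (i + 1)) f‖ ^ 2)

theorem pow_succ_apply' (A : H →L[ℝ] H) (i : ℕ) (f : H) : (A ^ (i + 1)) f = A ((A ^ i) f) := by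
  rw [pow_succ']; rfl

namespace IsSymmContraction

variable {A : H →L[ℝ] H} (hA : IsSymmContraction A)

theorem inner_pow_pow (hA : IsSymmContraction A) (f g : H) (i j : ℕ) :
    ⟪(A ^ i) f, (A ^ j) g⟫_ℝ = ⟪f, (A ^ (i + j)) g⟫_ℝ := by
  induction i generalizing j with
  | zero => simp
  | succ i ih =>
    rw [pow_succ_apply', hA.symm, ← pow_succ_apply', ih]
    congr 3; omega

theorem norm_pow_le (hA : IsSymmContraction A) (f : H) (i : ℕ) : ‖(A ^ i) f‖ ≤ ‖f‖ := by
  induction i with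
  | zero => simp
  | succ i ih => rw [pow_succ_apply']; exact (hA.norm_le _).trans ih

theorem abs_inner_pow_le (hA : IsSymmContraction A) (f : H) (i : ℕ) :
    |⟪f, (A ^ i) f⟫_ℝ| ≤ ‖f‖ ^ 2 := by
  refine (abs_real_inner_le_norm _ _).trans ?_
  rw [sq]
  exact mul_le_mul_of_nonneg_left (hA.norm_pow_le f i) (norm_nonneg _)

theorem inner_self_add_nonneg (hA : IsSymmContraction A) (x : H) : 0 ≤ ⟪x, x + A x⟫_ℝ := by
  have h := hA.abs_inner_pow_le x 1
  rw [pow_one] at h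
  rw [inner_add_right, real_inner_self_eq_norm_sq]
  linarith [(abs_le.1 h).1]

theorem inner_self_sub_nonneg (hA : IsSymmContraction A) (x : H) : 0 ≤ ⟪x, x - A x⟫_ℝ := by
  have h := hA.abs_inner_pow_le x 1
  rw [pow_one] at h
  rw [inner_sub_right, real_inner_self_eq_norm_sq]
  linarith [(abs_le.1 h).2]

theorem norm_add_sq_eq (hA : IsSymmContraction A) (f : H) (i : ℕ) :
    ‖(A ^ i) f + (A ^ (i + 1)) f‖ ^ 2 =
      ⟪f, (A ^ (2 * i)) f⟫_ℝ + 2 * ⟪f, (A ^ (2 * i + 1)) f⟫_ℝ + ⟪f, (A ^ (2 * i + 2)) f⟫_ℝ := by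
  rw [norm_add_sq_real, ← real_inner_self_eq_norm_sq, ← real_inner_self_eq_norm_sq,
    hA.inner_pow_pow, hA.inner_pow_pow, hA.inner_pow_pow]
  ring_nf

end IsSymmContraction

/-- The partial sum `∑_{|k| ≤ n} a |k|` of a symmetric autocovariance sequence. -/
def autocovSum (a : ℕ → ℝ) (n : ℕ) : ℝ :=
  a 0 + 2 * ∑ k ∈ Finset.range n, a (k + 1)

theorem autocovSum_succ (a : ℕ → ℝ) (n : ℕ) :
    autocovSum a (n + 1) = autocovSum a n + 2 * a (n + 1) := by
  simp only [autocovSum, Finset.sum_range_succ]; ring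

theorem tendsto_cesaro_atTop {u : ℕ → ℝ} (hu : Tendsto u atTop atTop) :
    Tendsto (fun n : ℕ => (n : ℝ)⁻¹ * ∑ i ∈ Finset.range n, u i) atTop atTop := by
  refine tendsto_atTop.2 fun C => ?_
  -- Truncating `u` at `C + 1` gives a sequence that is eventually constant.
  have h1 : Tendsto (fun n => min (u n) (C + 1)) atTop (𝓝 (C + 1)) := by
    refine tendsto_const_nhds.congr' ?_
    filter_upwards [hu.eventually_ge_atTop (C + 1)] with n hn
    rw [min_eq_right hn]
  filter_upwards [h1.cesaro.eventually (lt_mem_nhds (lt_add_one C))] with n hn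
  refine hn.le.trans ?_
  gcongr
  exact min_le_left _ _

namespace IsSymmContraction

variable {A : H →L[ℝ] H}

theorem autocovSum_even_odd (hA : IsSymmContraction A) (f : H) (m : ℕ) :
    autocovSum (fun k => ⟪f, (A ^ k) f⟫_ℝ) (2 * m) =
        ∑ i ∈ Finset.range m, ‖(A ^ i) f + (A ^ (i + 1)) f‖ ^ 2 + ⟪f, (A ^ (2 * m)) f⟫_ℝ ∧
      autocovSum (fun k => ⟪f, (A ^ k) f⟫_ℝ) (2 * m + 1) =
        ∑ i ∈ Finset.range (m + 1), ‖(A ^ i) f + (A ^ (i + 1)) f‖ ^ 2 -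
          ⟪f, (A ^ (2 * m + 2)) f⟫_ℝ := by
  induction m with
  | zero =>
    simp only [hA.norm_add_sq_eq]
    simp [autocovSum]
  | succ m ih =>
    have h1 := autocovSum_succ (fun k => ⟪f, (A ^ k) f⟫_ℝ) (2 * m + 1)
    have h2 := autocovSum_succ (fun k => ⟪f, (A ^ k) f⟫_ℝ) (2 * m + 2)
    have h3 := hA.norm_add_sq_eq f (m + 1)
    rw [Finset.sum_range_succ _ (m + 1)]
    simp only [mul_add, mul_one, add_assoc, Nat.reduceAdd] at h1 h2 h3 ih ⊢
    constructor <;> linarith [ih.2]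

/-- The sums `∑_{|k| ≤ n} a |k|` oscillate when `-1` is in the spectrum; adding `a (n + 1)`
turns them into averages of two consecutive ones, which are close to the partial sums of the
series defining `operatorVariance`. -/
theorem abs_autocovSum_sub_le (hA : IsSymmContraction A) (f : H) (n : ℕ) :
    |autocovSum (fun k => ⟪f, (A ^ k) f⟫_ℝ) n + ⟪f, (A ^ (n + 1)) f⟫_ℝ -
        ∑ i ∈ Finset.range ((n + 1) / 2), ‖(A ^ i) f + (A ^ (i + 1)) f‖ ^ 2| ≤
      ‖f‖ * ‖(A ^ (n / 2)) f + (A ^ (n / 2 + 1)) f‖ := by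
  obtain ⟨m, rfl | rfl⟩ := n.even_or_odd'
  · have e1 : (2 * m + 1) / 2 = m := by omega
    have e2 : 2 * m / 2 = m := by omega
    rw [e1, e2, (hA.autocovSum_even_odd f m).1]
    have h : ⟪(A ^ m) f, (A ^ m) f + (A ^ (m + 1)) f⟫_ℝ =
        ⟪f, (A ^ (2 * m)) f⟫_ℝ + ⟪f, (A ^ (2 * m + 1)) f⟫_ℝ := by
      rw [inner_add_right, hA.inner_pow_pow, hA.inner_pow_pow]
      ring_nf
    rw [show ∀ s : ℝ, s + ⟪f, (A ^ (2 * m)) f⟫_ℝ + ⟪f, (A ^ (2 * m + 1)) f⟫_ℝ - s =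
      ⟪f, (A ^ (2 * m)) f⟫_ℝ + ⟪f, (A ^ (2 * m + 1)) f⟫_ℝ from fun s => by ring, ← h]
    refine (abs_real_inner_le_norm _ _).trans ?_
    gcongr
    exact hA.norm_pow_le f m
  · have e1 : (2 * m + 1 + 1) / 2 = m + 1 := by omega
    rw [e1, (hA.autocovSum_even_odd f m).2]
    simp only [add_assoc, Nat.reduceAdd, sub_add_cancel, sub_self, abs_zero]
    positivity

/-- The Cesàro means of the partial autocovariance sums converge in `[0, ∞]`. -/
theorem tendsto_cesaro_autocovSum (hA : IsSymmContraction A) (f : H) :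
    Tendsto (fun n : ℕ => ENNReal.ofReal ((n : ℝ)⁻¹ *
      ∑ i ∈ Finset.range n, autocovSum (fun k => ⟪f, (A ^ k) f⟫_ℝ) i))
      atTop (𝓝 (operatorVariance A f)) := by
  set a : ℕ → ℝ := fun k => ⟪f, (A ^ k) f⟫_ℝ with ha
  set u : ℕ → ℝ := fun i => ‖(A ^ i) f + (A ^ (i + 1)) f‖ ^ 2 with hu
  have hu0 : ∀ i, 0 ≤ u i := fun i => by positivity
  have hab : ∀ k, |a k| ≤ ‖f‖ ^ 2 := hA.abs_inner_pow_le f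
  have hub : ∀ i, ‖(A ^ i) f + (A ^ (i + 1)) f‖ ≤ 2 * ‖f‖ := fun i => by
    refine (norm_add_le _ _).trans ?_
    linarith [hA.norm_pow_le f i, hA.norm_pow_le f (i + 1)]
  have hclose := hA.abs_autocovSum_sub_le f
  have hhalf : Tendsto (fun n : ℕ => n / 2) atTop atTop :=
    Nat.tendsto_div_const_atTop (by norm_num)
  have hhalf' : Tendsto (fun n : ℕ => (n + 1) / 2) atTop atTop :=
    hhalf.comp (tendsto_add_atTop_nat 1)
  by_cases hs : Summable u
  · have hV : operatorVariance A f = ENNReal.ofReal (∑' i, u i) :=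
      (ENNReal.ofReal_tsum_of_nonneg hu0 hs).symm
    rw [hV]
    refine ENNReal.tendsto_ofReal ?_
    have hsq : Tendsto (fun i => ‖f‖ * ‖(A ^ i) f + (A ^ (i + 1)) f‖) atTop (𝓝 0) := by
      have := (hs.tendsto_atTop_zero.sqrt).const_mul ‖f‖
      simpa [hu, Real.sqrt_sq] using this
    have hc : Tendsto (fun n => autocovSum a n + a (n + 1)) atTop (𝓝 (∑' i, u i)) := by
      have h1 : Tendsto (fun n => ∑ i ∈ Finset.range ((n + 1) / 2), u i) atTop (𝓝 (∑' i, u i)) :=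
        hs.hasSum.tendsto_sum_nat.comp hhalf'
      have h2 := squeeze_zero_norm (fun n => (Real.norm_eq_abs _).trans_le (hclose n))
        (hsq.comp hhalf)
      simpa [ha, hu] using h2.add h1
    -- As the `autocovSum a n` are bounded, so are the sums of the `a k`, and their means vanish.
    have hSb : ∃ C, ∀ n, |autocovSum a n| ≤ C := by
      obtain ⟨C, hC⟩ := hc.bddAbove_range
      obtain ⟨C', hC'⟩ := hc.bddBelow_range
      refine ⟨max C (-C') + ‖f‖ ^ 2, fun n => ?_⟩
      have h1 := hC ⟨n, rfl⟩
      have h2 := hC' ⟨n, rfl⟩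
      have h3 := abs_le.1 (hab (n + 1))
      simp only at h1 h2
      rw [abs_le]
      constructor <;> linarith [le_max_left C (-C'), le_max_right C (-C')]
    obtain ⟨C, hC⟩ := hSb
    have hinv : Tendsto (fun n : ℕ => (n : ℝ)⁻¹) atTop (𝓝 0) := tendsto_inv_atTop_nhds_zero_nat
    have hb : Tendsto (fun n : ℕ => (n : ℝ)⁻¹ * ∑ i ∈ Finset.range n, a (i + 1))
        atTop (𝓝 0) := by
      have hle : ∀ n : ℕ, ‖(n : ℝ)⁻¹ * ∑ i ∈ Finset.range n, a (i + 1)‖ ≤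
          (n : ℝ)⁻¹ * (C + ‖f‖ ^ 2) := fun n => by
        have h1 : autocovSum a n = a 0 + 2 * ∑ i ∈ Finset.range n, a (i + 1) := rfl
        have h2 := abs_le.1 (hC n)
        have h3 := abs_le.1 (hab 0)
        rw [norm_mul, Real.norm_eq_abs, Real.norm_eq_abs, abs_of_nonneg (by positivity)]
        gcongr
        rw [abs_le]
        constructor <;> linarith
      refine squeeze_zero_norm hle ?_
      simpa using hinv.mul_const (C + ‖f‖ ^ 2)
    have := hc.cesaro.sub hb
    simpa [Finset.sum_add_distrib, mul_add] using this
  · -- The partial sums of the series tend to `∞`, and the autocovariances are bounded.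
    have hV : operatorVariance A f = ∞ := by
      by_contra h
      exact hs (by
        simpa only [hu, ENNReal.toReal_ofReal, sq_nonneg] using ENNReal.summable_toReal h)
    rw [hV]
    refine ENNReal.tendsto_ofReal_atTop.comp (tendsto_cesaro_atTop ?_)
    have h1 : Tendsto (fun n => ∑ i ∈ Finset.range ((n + 1) / 2), u i) atTop atTop :=
      ((not_summable_iff_tendsto_nat_atTop_of_nonneg hu0).1 hs).comp hhalf'
    refine tendsto_atTop_mono (fun n => ?_) (tendsto_atTop_add_const_right _ (-(3 * ‖f‖ ^ 2)) h1)
    have h2 := (abs_le.1 (hclose n)).1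
    have h3 := abs_le.1 (hab (n + 1))
    have h4 := mul_le_mul_of_nonneg_left (hub (n / 2)) (norm_nonneg f)
    simp only [ha, hu] at h3 ⊢
    nlinarith

end IsSymmContraction

/-- The vector `f + ∑_{i < m} (1 + A)² A²ⁱ f`, half of which approximates the maximiser of
`h ↦ 2 ⟨f, h⟩ - ⟨h, (1 - A) h⟩`. -/
def approxMax (A : H →L[ℝ] H) (f : H) (m : ℕ) : H :=
  f + ∑ i ∈ Finset.range m,
    ((A ^ (2 * i)) f + (2 : ℝ) • (A ^ (2 * i + 1)) f + (A ^ (2 * i + 2)) f)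

theorem approxMax_sub (A : H →L[ℝ] H) (f : H) (m : ℕ) :
    approxMax A f m - A (approxMax A f m) =
      (2 : ℝ) • f - ((A ^ (2 * m)) f + (A ^ (2 * m + 1)) f) := by
  induction m with
  | zero => simp [approxMax]; module
  | succ m ih =>
    have h : approxMax A f (m + 1) = approxMax A f m +
        ((A ^ (2 * m)) f + (2 : ℝ) • (A ^ (2 * m + 1)) f + (A ^ (2 * m + 2)) f) := by
      simp only [approxMax, Finset.sum_range_succ, add_assoc]
    rw [h, map_add, add_sub_add_comm, ih]
    simp only [map_add, map_smul, ← pow_succ_apply', mul_add, mul_one, add_assoc, Nat.reduceAdd]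
    module

namespace IsSymmContraction

variable {A : H →L[ℝ] H}

theorem inner_approxMax (hA : IsSymmContraction A) (f : H) (m : ℕ) :
    ⟪f, approxMax A f m⟫_ℝ =
      ‖f‖ ^ 2 + ∑ i ∈ Finset.range m, ‖(A ^ i) f + (A ^ (i + 1)) f‖ ^ 2 := by
  simp only [approxMax, inner_add_right, inner_sum, inner_smul_right, hA.norm_add_sq_eq,
    real_inner_self_eq_norm_sq]

theorem inner_approxMax_remainder_nonneg (hA : IsSymmContraction A) (f : H) (m : ℕ) :
    0 ≤ ⟪approxMax A f m, (A ^ (2 * m)) f + (A ^ (2 * m + 1)) f⟫_ℝ := by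
  rw [approxMax, inner_add_left, sum_inner]
  refine add_nonneg ?_ (Finset.sum_nonneg fun i _ => ?_)
  · have h := hA.inner_self_add_nonneg ((A ^ m) f)
    rw [← pow_succ_apply', inner_add_right, hA.inner_pow_pow, hA.inner_pow_pow] at h
    rw [inner_add_right]
    simpa only [two_mul, add_assoc] using h
  · have h := hA.inner_self_add_nonneg ((A ^ (i + m)) f + (A ^ (i + m + 1)) f)
    simp only [map_add, ← pow_succ_apply', inner_add_right, inner_add_left, hA.inner_pow_pow,
      inner_smul_left, RCLike.conj_to_real] at h ⊢
    ring_nf at h ⊢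
    linarith

/-- The functional `h ↦ 2 ⟨f, h⟩ - ⟨h, (1 - A) h⟩` at half of `approxMax A f m` bounds the partial
sums of `operatorVariance`. The error term is nonnegative because `m` steps of `A²` leave an even
power of `A` in the remainder `approxMax_sub`. -/
theorem le_functional_approxMax (hA : IsSymmContraction A) (f : H) (m : ℕ) :
    ‖f‖ ^ 2 + ∑ i ∈ Finset.range m, ‖(A ^ i) f + (A ^ (i + 1)) f‖ ^ 2 ≤
      2 * (2 * ⟪f, (2⁻¹ : ℝ) • approxMax A f m⟫_ℝ -
        ⟪(2⁻¹ : ℝ) • approxMax A f m,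
          (2⁻¹ : ℝ) • approxMax A f m - A ((2⁻¹ : ℝ) • approxMax A f m)⟫_ℝ) := by
  rw [map_smul, ← smul_sub, approxMax_sub, ← hA.inner_approxMax]
  have h := hA.inner_approxMax_remainder_nonneg f m
  simp only [inner_smul_left, inner_smul_right, inner_sub_right, RCLike.conj_to_real]
  rw [real_inner_comm f (approxMax A f m)]
  linarith

/-- An upper bound of the functional `h ↦ 2 ⟨f, h⟩ - ⟨h, (1 - A) h⟩` by partial sums of
`operatorVariance`, up to a term that tends to zero when the series converges. -/
theorem functional_le (hA : IsSymmContraction A) (f h : H) (m : ℕ) :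
    2 * (2 * ⟪f, h⟫_ℝ - ⟪h, h - A h⟫_ℝ) ≤
      ‖f‖ ^ 2 + ∑ i ∈ Finset.range m, ‖(A ^ i) f + (A ^ (i + 1)) f‖ ^ 2 +
        2 * (‖h‖ * ‖(A ^ m) f + (A ^ (m + 1)) f‖) := by
  set k := approxMax A f m with hk
  set e := (A ^ (2 * m)) f + (A ^ (2 * m + 1)) f with he
  have h1 : k - A k = (2 : ℝ) • f - e := approxMax_sub A f m
  -- The quadratic form of `1 - A` is nonnegative at the difference of `h` and the near maximiser.
  have h0 := hA.inner_self_sub_nonneg (h - (2⁻¹ : ℝ) • k)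
  have h2 : h - (2⁻¹ : ℝ) • k - A (h - (2⁻¹ : ℝ) • k) =
      (h - A h) - (2⁻¹ : ℝ) • ((2 : ℝ) • f - e) := by
    rw [← h1, map_sub, map_smul]; module
  rw [h2] at h0
  have h3 : ⟪k, h - A h⟫_ℝ = 2 * ⟪f, h⟫_ℝ - ⟪e, h⟫_ℝ := by
    rw [inner_sub_right, ← hA.symm, ← inner_sub_left, h1, inner_sub_left, inner_smul_left]
    simp
  have h4 := hA.inner_approxMax f m
  have h5 := hA.inner_approxMax_remainder_nonneg f m
  rw [← hk] at h4 h5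
  rw [← he] at h5
  have h6 : ⟪h, e⟫_ℝ ≤ ‖h‖ * ‖(A ^ m) f + (A ^ (m + 1)) f‖ := by
    refine (real_inner_le_norm _ _).trans ?_
    gcongr
    have : e = (A ^ m) ((A ^ m) f + (A ^ (m + 1)) f) := by
      rw [he, map_add, ← mul_apply_eq_comp, ← mul_apply_eq_comp, ← pow_add, ← pow_add]
      ring_nf
    rw [this]
    exact hA.norm_pow_le _ m
  rw [inner_sub_left, inner_sub_right, inner_sub_right (x := (2⁻¹ : ℝ) • k)] at h0
  simp only [inner_smul_left, inner_smul_right, RCLike.conj_to_real, h3] at h0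
  rw [inner_sub_right h ((2 : ℝ) • f), inner_sub_right k ((2 : ℝ) • f)] at h0
  simp only [inner_smul_right] at h0
  rw [real_inner_comm f h, real_inner_comm f k, real_inner_comm e h] at h0
  rw [real_inner_comm e h] at h6
  linarith

end IsSymmContraction

/-- Comparison of asymptotic variances, from the variational formula
`⟨f, (1 - A)⁻¹ f⟩ = sup_h (2 ⟨f, h⟩ - ⟨h, (1 - A) h⟩)` and the scaling `h ↦ ϱ h`. -/
theorem operatorVariance_le {A B : H →L[ℝ] H} (hA : IsSymmContraction A)
    (hB : IsSymmContraction B) {s : ℝ} (hs0 : 0 < s) (hs1 : s ≤ 1)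
    (hAB : ∀ h, s * ⟪h, h - A h⟫_ℝ ≤ ⟪h, h - B h⟫_ℝ) (f : H) :
    operatorVariance B f ≤ ENNReal.ofReal (s⁻¹ - 1) * ENNReal.ofReal (‖f‖ ^ 2) +
      ENNReal.ofReal s⁻¹ * operatorVariance A f := by
  by_cases hV : operatorVariance A f = ∞
  · rw [hV, ENNReal.mul_top (by simpa using hs0), add_top]
    exact le_top
  have hs : Summable fun i : ℕ => ‖(A ^ i) f + (A ^ (i + 1)) f‖ ^ 2 := by
    simpa only [ENNReal.toReal_ofReal, sq_nonneg] using ENNReal.summable_toReal hV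
  have hVA : operatorVariance A f =
      ENNReal.ofReal (∑' i : ℕ, ‖(A ^ i) f + (A ^ (i + 1)) f‖ ^ 2) :=
    (ENNReal.ofReal_tsum_of_nonneg (fun _ => sq_nonneg _) hs).symm
  have hup : ∀ h : H, 2 * (2 * ⟪f, h⟫_ℝ - ⟪h, h - A h⟫_ℝ) ≤
      ‖f‖ ^ 2 + ∑' i : ℕ, ‖(A ^ i) f + (A ^ (i + 1)) f‖ ^ 2 := fun h => by
    have h1 := (hs.tendsto_atTop_zero.sqrt).const_mul ‖h‖
    simp only [Real.sqrt_sq (norm_nonneg _), Real.sqrt_zero, mul_zero] at h1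
    have h2 := (hs.hasSum.tendsto_sum_nat.const_add (‖f‖ ^ 2)).add (h1.const_mul 2)
    rw [mul_zero, add_zero] at h2
    exact ge_of_tendsto' h2 fun m => hA.functional_le f h m
  have hs' : 0 ≤ s⁻¹ - 1 := by
    have := (one_le_inv₀ hs0).2 hs1
    linarith
  rw [hVA, ← ENNReal.ofReal_mul hs', ← ENNReal.ofReal_mul (by positivity),
    ← ENNReal.ofReal_add (by positivity)
      (mul_nonneg (by positivity) (tsum_nonneg fun _ => sq_nonneg _))]
  refine ENNReal.tsum_le_of_sum_range_le fun m => ?_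
  rw [← ENNReal.ofReal_sum_of_nonneg fun _ _ => sq_nonneg _]
  refine ENNReal.ofReal_le_ofReal ?_
  set V := ∑' i : ℕ, ‖(A ^ i) f + (A ^ (i + 1)) f‖ ^ 2
  set h := (2⁻¹ : ℝ) • approxMax B f m with hh
  have h1 := hB.le_functional_approxMax f m
  rw [← hh] at h1
  clear_value h
  have h2 := hAB h
  have h3 := hup (s • h)
  rw [map_smul, ← smul_sub, inner_smul_left, inner_smul_right, inner_smul_right,
    RCLike.conj_to_real] at h3
  have h4 : 2 * (2 * ⟪f, h⟫_ℝ - s * ⟪h, h - A h⟫_ℝ) ≤ s⁻¹ * (‖f‖ ^ 2 + V) := by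
    rw [le_inv_mul_iff₀ hs0]
    linarith
  linarith

end Hilbert

/-! ### The operator of a reversible kernel on `L²` -/

section TransitionOperator

open scoped InnerProductSpace

variable {X : Type*} [MeasurableSpace X]

theorem lintegral_sq_eq_norm_sq {mu : Measure X} (g : Lp ℝ 2 mu) :
    ∫⁻ x, ENNReal.ofReal (g x ^ 2) ∂mu = ENNReal.ofReal (‖g‖ ^ 2) := by
  rw [← ofReal_integral_eq_lintegral_ofReal (Lp.memLp g).integrable_sq
    (ae_of_all _ fun x => sq_nonneg _), ← real_inner_self_eq_norm_sq, L2.inner_def]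
  simp only [real_inner_self_eq_norm_sq, Real.norm_eq_abs, sq_abs]

variable {mu : Measure X} [IsProbabilityMeasure mu] {K : Kernel X X} [IsMarkovKernel K]

theorem measurePreserving_fst_compProd (mu : Measure X) [IsProbabilityMeasure mu]
    (K : Kernel X X) [IsMarkovKernel K] : MeasurePreserving Prod.fst (mu ⊗ₘ K) mu :=
  ⟨measurable_fst, Measure.fst_compProd mu K⟩

theorem measurePreserving_snd_compProd (hK : K.Invariant mu) :
    MeasurePreserving Prod.snd (mu ⊗ₘ K) mu :=
  ⟨measurable_snd, (Measure.snd_compProd mu K).trans hK⟩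

theorem measurePreserving_swap_compProd (hK : K.IsReversible mu) :
    MeasurePreserving Prod.swap (mu ⊗ₘ K) (mu ⊗ₘ K) := by
  refine ⟨measurable_swap, Measure.ext_prod fun {s t} hs ht => ?_⟩
  rw [Measure.map_apply measurable_swap (hs.prod ht), Set.preimage_swap_prod,
    Measure.compProd_apply_prod ht hs, Measure.compProd_apply_prod hs ht, hK ht hs]

/-- The map `f ↦ ((x, y) ↦ f x)` from `L²(μ)` to `L²` of the joint law of one transition. -/
def fstLp (mu : Measure X) [IsProbabilityMeasure mu] (K : Kernel X X) [IsMarkovKernel K] :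
    Lp ℝ 2 mu →ₗᵢ[ℝ] Lp ℝ 2 (mu ⊗ₘ K) :=
  Lp.compMeasurePreservingₗᵢ ℝ Prod.fst (measurePreserving_fst_compProd mu K)

/-- The map `f ↦ ((x, y) ↦ f y)` from `L²(μ)` to `L²` of the joint law of one transition. -/
def sndLp (hK : K.Invariant mu) : Lp ℝ 2 mu →ₗᵢ[ℝ] Lp ℝ 2 (mu ⊗ₘ K) :=
  Lp.compMeasurePreservingₗᵢ ℝ Prod.snd (measurePreserving_snd_compProd hK)

/-- The operator `f ↦ (x ↦ ∫ f(y) K(x, dy))` on `L²(μ)` (see `transitionOp_ae_eq`), obtained by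
composing with the projection to the second coordinate, followed by the adjoint of the composition
with the projection to the first one. -/
def transitionOp (hK : K.Invariant mu) : Lp ℝ 2 mu →L[ℝ] Lp ℝ 2 mu :=
  (ContinuousLinearMap.adjoint (fstLp mu K).toContinuousLinearMap).comp
    (sndLp hK).toContinuousLinearMap

theorem inner_transitionOp (hK : K.Invariant mu) (f g : Lp ℝ 2 mu) :
    ⟪f, transitionOp hK g⟫_ℝ = ⟪fstLp mu K f, sndLp hK g⟫_ℝ :=
  ContinuousLinearMap.adjoint_inner_right (fstLp mu K).toContinuousLinearMap f (sndLp hK g)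

theorem isSymmContraction_transitionOp (hK : K.IsReversible mu) :
    IsSymmContraction (transitionOp hK.invariant) where
  symm f g := by
    let W : Lp ℝ 2 (mu ⊗ₘ K) →ₗᵢ[ℝ] Lp ℝ 2 (mu ⊗ₘ K) :=
      Lp.compMeasurePreservingₗᵢ ℝ Prod.swap (measurePreserving_swap_compProd hK)
    have h1 : W (fstLp mu K g) = sndLp hK.invariant g :=
      (Lp.compMeasurePreserving_comp_apply g (measurePreserving_fst_compProd mu K)
        (measurePreserving_swap_compProd hK)).symm
    have h2 : W (sndLp hK.invariant f) = fstLp mu K f :=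
      (Lp.compMeasurePreserving_comp_apply f (measurePreserving_snd_compProd hK.invariant)
        (measurePreserving_swap_compProd hK)).symm
    rw [real_inner_comm, inner_transitionOp, inner_transitionOp, ← W.inner_map_map, h1, h2,
      real_inner_comm]
  norm_le f := by
    rw [← sq_le_sq₀ (norm_nonneg _) (norm_nonneg _), sq, ← real_inner_self_eq_norm_mul_norm,
      inner_transitionOp]
    have h := real_inner_le_norm (fstLp mu K (transitionOp hK.invariant f)) (sndLp hK.invariant f)
    rw [LinearIsometry.norm_map, LinearIsometry.norm_map] at h
    have h2 : ⟪transitionOp hK.invariant f, transitionOp hK.invariant f⟫_ℝ =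
      ‖transitionOp hK.invariant f‖ * ‖transitionOp hK.invariant f‖ :=
        real_inner_self_eq_norm_mul_norm _
    rw [inner_transitionOp] at h2
    nlinarith [norm_nonneg f, norm_nonneg (transitionOp hK.invariant f)]

theorem transitionOp_ae_eq (hK : K.Invariant mu) (g : Lp ℝ 2 mu) :
    transitionOp hK g =ᵐ[mu] fun x => ∫ y, g y ∂(K x) := by
  have hint : Integrable (fun z : X × X => g z.2) (mu ⊗ₘ K) :=
    (measurePreserving_snd_compProd hK).integrable_comp_of_integrable
      ((Lp.memLp g).integrable one_le_two)
  have hint' : Integrable (fun x => ∫ y, g y ∂(K x)) mu :=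
    Integrable.integral_compProd (κ := Kernel.const Unit mu) (η := Kernel.prodMkLeft Unit K)
      (a := ()) hint
  refine Integrable.ae_eq_of_forall_setIntegral_eq _ _
    ((Lp.memLp (transitionOp hK g)).integrable one_le_two)
    hint' fun s hs _ => ?_
  rw [← L2.inner_indicatorConstLp_one (𝕜 := ℝ) hs (measure_ne_top mu s), inner_transitionOp]
  have h1 : fstLp mu K (indicatorConstLp 2 hs (measure_ne_top mu s) (1 : ℝ)) =
      indicatorConstLp 2 (measurable_fst hs) (measure_ne_top (mu ⊗ₘ K) _) (1 : ℝ) :=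
    Lp.indicatorConstLp_compMeasurePreserving hs (measure_ne_top mu s) 1
      (measurePreserving_fst_compProd mu K)
  rw [h1, L2.inner_indicatorConstLp_one]
  have h2 : sndLp hK g =ᵐ[mu ⊗ₘ K] fun z => g z.2 :=
    Lp.coeFn_compMeasurePreserving g (measurePreserving_snd_compProd hK)
  rw [setIntegral_congr_ae₀ (measurable_fst hs).nullMeasurableSet (h2.mono fun z hz _ => hz),
    show (Prod.fst ⁻¹' s : Set (X × X)) = s ×ˢ Set.univ by ext; simp,
    Measure.setIntegral_compProd hs MeasurableSet.univ hint.integrableOn]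
  simp

theorem dirichletForm_eq (hK : K.Invariant mu) (g : Lp ℝ 2 mu) :
    dirichletForm K mu g = ENNReal.ofReal ⟪g, g - transitionOp hK g⟫_ℝ := by
  have hm : Measurable g := (Lp.stronglyMeasurable g).measurable
  have h1 : ∫⁻ x, ∫⁻ y, ENNReal.ofReal ((g x - g y) ^ 2) ∂(K x) ∂mu =
      ∫⁻ z, ENNReal.ofReal ((g z.1 - g z.2) ^ 2) ∂(mu ⊗ₘ K) := by
    rw [Measure.lintegral_compProd]
    fun_prop
  have h2 : (fstLp mu K g - sndLp hK g : Lp ℝ 2 (mu ⊗ₘ K)) =ᵐ[mu ⊗ₘ K]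
      fun z => g z.1 - g z.2 :=
    (Lp.coeFn_sub _ _).trans
      ((Lp.coeFn_compMeasurePreserving g (measurePreserving_fst_compProd mu K)).sub
        (Lp.coeFn_compMeasurePreserving g (measurePreserving_snd_compProd hK)))
  rw [dirichletForm, h1, ← lintegral_congr_ae (h2.mono fun z hz =>
    congrArg (fun t : ℝ => ENNReal.ofReal (t ^ 2)) hz), lintegral_sq_eq_norm_sq,
    show (2⁻¹ : ℝ≥0∞) = ENNReal.ofReal 2⁻¹ by
      rw [ENNReal.ofReal_inv_of_pos two_pos, ENNReal.ofReal_ofNat],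
    ← ENNReal.ofReal_mul (by positivity), norm_sub_sq_real, ← inner_transitionOp,
    LinearIsometry.norm_map, LinearIsometry.norm_map, inner_sub_right, real_inner_self_eq_norm_sq]
  ring_nf

end TransitionOperator

/-! ### The stationary chain -/

section Chain

open scoped InnerProductSpace

variable {X : Type*} [MeasurableSpace X]

theorem map_chainLaw_zero (mu : Measure X) (K : Kernel X X) [IsMarkovKernel K] :
    (chainLaw K mu).map (fun w => w 0) = mu := by
  have h : (fun w : ℕ → X => w 0) =
      (fun h : (∀ _ : Finset.Iic 0, X) => h ⟨0, by simp⟩) ∘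
        (Preorder.frestrictLe (π := fun _ : ℕ => X) 0) := rfl
  rw [h, ← Measure.map_map (by fun_prop) (by fun_prop), chainLaw, Kernel.trajMeasure,
    Measure.map_comp _ _ (by fun_prop), Kernel.traj_map_frestrictLe, Kernel.partialTraj_self,
    Measure.id_comp, Measure.map_map (by fun_prop) (by fun_prop)]
  exact Measure.map_id

variable {mu : Measure X} [IsProbabilityMeasure mu] {K : Kernel X X} [IsMarkovKernel K]

instance : IsProbabilityMeasure (chainLaw K mu) := by
  unfold chainLaw; infer_instance

/-- The Markov property: the joint law of the path up to time `n` and the state at time `n + 1`. -/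
theorem map_chainLaw_succ (n : ℕ) :
    (chainLaw K mu).map
        (fun w => (Preorder.frestrictLe (π := fun _ : ℕ => X) n w, w (n + 1))) =
      (chainLaw K mu).map (Preorder.frestrictLe (π := fun _ : ℕ => X) n) ⊗ₘ
        K.comap (fun h : (∀ _ : Finset.Iic n, X) => h ⟨n, by simp⟩) (measurable_pi_apply _) :=
  Kernel.map_frestrictLe_trajMeasure_compProd_eq_map_trajMeasure.symm

theorem measurePreserving_eval_chainLaw (hK : K.Invariant mu) (n : ℕ) :
    MeasurePreserving (fun w : ℕ → X => w n) (chainLaw K mu) mu := by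
  refine ⟨measurable_pi_apply n, ?_⟩
  induction n with
  | zero => exact map_chainLaw_zero mu K
  | succ n ih =>
    have h1 := congrArg Measure.snd (map_chainLaw_succ (K := K) (mu := mu) n)
    rw [Measure.snd_compProd, Measure.snd_map_prodMk (by fun_prop)] at h1
    rw [h1]
    ext s hs
    rw [Measure.bind_apply hs (Kernel.aemeasurable _), lintegral_map (Kernel.measurable_coe _ hs)
      (by fun_prop)]
    simp only [Kernel.comap_apply]
    conv_rhs => rw [← hK.def, Measure.bind_apply hs (Kernel.aemeasurable _), ← ih,
      lintegral_map (Kernel.measurable_coe _ hs) (by fun_prop)]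
    rfl

/-- The Markov property for products: given the path up to time `n`, the state at time `n + 1` is
averaged with respect to `K (w n)`. -/
theorem integral_mul_succ_chainLaw {f h : X → ℝ} (hf : Measurable f) (hh : Measurable h)
    {i n : ℕ} (hin : i ≤ n)
    (hint : Integrable (fun w => f (w i) * h (w (n + 1))) (chainLaw K mu)) :
    ∫ w, f (w i) * h (w (n + 1)) ∂(chainLaw K mu) =
      ∫ w, f (w i) * ∫ y, h y ∂(K (w n)) ∂(chainLaw K mu) := by
  let φ : (ℕ → X) → (∀ _ : Finset.Iic n, X) × X :=
    fun w => (Preorder.frestrictLe (π := fun _ : ℕ => X) n w, w (n + 1))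
  have hφ : Measurable φ := by fun_prop
  let F : (∀ _ : Finset.Iic n, X) × X → ℝ := fun z => f (z.1 ⟨i, by simpa using hin⟩) * h z.2
  have hF : Measurable F := by fun_prop
  have h1 : ∫ w, f (w i) * h (w (n + 1)) ∂(chainLaw K mu) =
      ∫ z, F z ∂((chainLaw K mu).map φ) :=
    (integral_map hφ.aemeasurable hF.aestronglyMeasurable).symm
  have h2 : Integrable F ((chainLaw K mu).map φ) :=
    (integrable_map_measure hF.aestronglyMeasurable hφ.aemeasurable).2 hint
  rw [map_chainLaw_succ] at h1 h2
  have hsm : StronglyMeasurable fun x => ∫ y, h y ∂(K x) :=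
    hh.stronglyMeasurable.integral_kernel
  rw [h1, Measure.integral_compProd h2, integral_map (by fun_prop)]
  · simp only [F, Kernel.comap_apply, integral_const_mul]
    rfl
  · simp only [F, Kernel.comap_apply, integral_const_mul]
    refine Measurable.aestronglyMeasurable ?_
    exact (hf.comp (measurable_pi_apply _)).mul (hsm.measurable.comp (measurable_pi_apply _))

/-- The embedding `f ↦ f (w n)` of `L²(μ)` into `L²` of the law of the stationary chain. -/
def evalLp (hK : K.Invariant mu) (n : ℕ) : Lp ℝ 2 mu →ₗᵢ[ℝ] Lp ℝ 2 (chainLaw K mu) :=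
  Lp.compMeasurePreservingₗᵢ ℝ (fun w : ℕ → X => w n) (measurePreserving_eval_chainLaw hK n)

theorem evalLp_ae_eq (hK : K.Invariant mu) (n : ℕ) (f : Lp ℝ 2 mu) :
    evalLp hK n f =ᵐ[chainLaw K mu] fun w => f (w n) :=
  Lp.coeFn_compMeasurePreserving f (measurePreserving_eval_chainLaw hK n)

theorem inner_evalLp_succ (hK : K.Invariant mu) {i n : ℕ} (hin : i ≤ n) (f h : Lp ℝ 2 mu) :
    ⟪evalLp hK i f, evalLp hK (n + 1) h⟫_ℝ =
      ⟪evalLp hK i f, evalLp hK n (transitionOp hK h)⟫_ℝ := by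
  have hf : Measurable f := (Lp.stronglyMeasurable f).measurable
  have hh : Measurable h := (Lp.stronglyMeasurable h).measurable
  have e1 : (fun w => ⟪evalLp hK i f w, evalLp hK (n + 1) h w⟫_ℝ) =ᵐ[chainLaw K mu]
      fun w => f (w i) * h (w (n + 1)) := by
    filter_upwards [evalLp_ae_eq hK i f, evalLp_ae_eq hK (n + 1) h] with w h1 h2
    rw [h1, h2, real_inner_eq_re_inner, RCLike.inner_apply]
    simp [mul_comm]
  have e2 : (fun w => ⟪evalLp hK i f w, evalLp hK n (transitionOp hK h) w⟫_ℝ) =ᵐ[chainLaw K mu]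
      fun w => f (w i) * ∫ y, h y ∂(K (w n)) := by
    filter_upwards [evalLp_ae_eq hK i f, evalLp_ae_eq hK n (transitionOp hK h),
      (measurePreserving_eval_chainLaw hK n).quasiMeasurePreserving.ae (transitionOp_ae_eq hK h)]
      with w h1 h2 h3
    rw [h1, h2, h3, real_inner_eq_re_inner, RCLike.inner_apply]
    simp [mul_comm]
  rw [L2.inner_def, L2.inner_def, integral_congr_ae e1, integral_congr_ae e2]
  exact integral_mul_succ_chainLaw hf hh hin ((L2.integrable_inner _ _).congr e1)

/-- The autocovariances of the stationary chain. -/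
theorem inner_evalLp_add (hK : K.Invariant mu) (i k : ℕ) (f h : Lp ℝ 2 mu) :
    ⟪evalLp hK i f, evalLp hK (i + k) h⟫_ℝ = ⟪f, (transitionOp hK ^ k) h⟫_ℝ := by
  induction k generalizing h with
  | zero => simp
  | succ k ih =>
    rw [← add_assoc, inner_evalLp_succ hK (Nat.le_add_right i k), ih, pow_succ]
    rfl

theorem norm_sum_evalLp_sq (hK : K.Invariant mu) (f : Lp ℝ 2 mu) (n : ℕ) :
    ‖∑ i ∈ Finset.range n, evalLp hK i f‖ ^ 2 =
      ∑ j ∈ Finset.range n, autocovSum (fun k => ⟪f, (transitionOp hK ^ k) f⟫_ℝ) j := by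
  induction n with
  | zero => simp
  | succ n ih =>
    have h : ⟪∑ i ∈ Finset.range n, evalLp hK i f, evalLp hK n f⟫_ℝ =
        ∑ k ∈ Finset.range n, ⟪f, (transitionOp hK ^ (k + 1)) f⟫_ℝ := by
      rw [sum_inner, ← Finset.sum_range_reflect]
      refine Finset.sum_congr rfl fun k hk => ?_
      rw [Finset.mem_range] at hk
      rw [← inner_evalLp_add hK (n - 1 - k) (k + 1)]
      congr 3
      omega
    rw [Finset.sum_range_succ, Finset.sum_range_succ, norm_add_sq_real, ih, h,
      LinearIsometry.norm_map, autocovSum, pow_zero, one_apply_eq_self,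
      real_inner_self_eq_norm_sq]
    ring

theorem evariance_eq_of_integral_eq_zero {mu : Measure X} {f : X → ℝ} (hf : MemLp f 2 mu)
    (h0 : ∫ x, f x ∂mu = 0) : evariance f mu = ENNReal.ofReal (‖hf.toLp f‖ ^ 2) := by
  rw [evariance_eq_lintegral_ofReal, h0, ← lintegral_sq_eq_norm_sq]
  refine lintegral_congr_ae ?_
  filter_upwards [hf.coeFn_toLp] with x hx
  rw [hx, sub_zero]

theorem hasAsymptoticVariance_operatorVariance (hK : K.IsReversible mu) {f : X → ℝ}
    (hf : MemLp f 2 mu) (h0 : ∫ x, f x ∂mu = 0) :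
    HasAsymptoticVariance K mu f (operatorVariance (transitionOp hK.invariant) (hf.toLp f)) := by
  refine ((isSymmContraction_transitionOp hK).tendsto_cesaro_autocovSum (hf.toLp f)).congr
    fun n => ?_
  have hmp := measurePreserving_eval_chainLaw hK.invariant
  have hfi : ∀ i : ℕ, MemLp (fun w : ℕ → X => f (w i)) 2 (chainLaw K mu) :=
    fun i => hf.comp_measurePreserving (hmp i)
  simp only [h0, sub_zero]
  have hZ : MemLp (fun w : ℕ → X => (n : ℝ) ^ (-(1 / 2) : ℝ) * ∑ i ∈ Finset.range n, f (w i)) 2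
      (chainLaw K mu) := (memLp_finsetSum _ fun i _ => hfi i).const_mul _
  have hZ0 : ∫ w, (n : ℝ) ^ (-(1 / 2) : ℝ) * ∑ i ∈ Finset.range n, f (w i)
      ∂(chainLaw K mu) = 0 := by
    rw [integral_const_mul, integral_finsetSum _ fun i _ => (hfi i).integrable one_le_two,
      Finset.sum_eq_zero, mul_zero]
    intro i _
    have h1 := (hmp i).map_eq
    rw [← h0, ← integral_map (φ := fun w : ℕ → X => w i) (hmp i).measurable.aemeasurable
      (by rw [h1]; exact hf.1), h1]
  have hLp : hZ.toLp _ = (n : ℝ) ^ (-(1 / 2) : ℝ) •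
      ∑ i ∈ Finset.range n, evalLp hK.invariant i (hf.toLp f) := by
    have h1 : ∀ i, evalLp hK.invariant i (hf.toLp f) = (hfi i).toLp _ := fun i =>
      Lp.toLp_compMeasurePreserving hf (hmp i)
    simp only [h1]
    refine Lp.ext (hZ.coeFn_toLp.trans ?_)
    filter_upwards [Lp.coeFn_smul ((n : ℝ) ^ (-(1 / 2) : ℝ))
        (∑ i ∈ Finset.range n, (hfi i).toLp _),
      Lp.coeFn_finsetSum (Finset.range n) (fun i => (hfi i).toLp _),
      ae_all_iff.2 fun i => (hfi i).coeFn_toLp] with w h2 h3 h4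
    rw [h2, Pi.smul_apply, h3, Finset.sum_apply, smul_eq_mul]
    simp only [h4]
  rw [evariance_eq_of_integral_eq_zero hZ hZ0, hLp, norm_smul, mul_pow, norm_sum_evalLp_sq,
    Real.norm_eq_abs, sq_abs, ← Real.rpow_natCast, ← Real.rpow_mul (Nat.cast_nonneg n)]
  norm_num [Real.rpow_neg_one]

end Chain

/-! ### Kernels that propose and accept -/

section ProposalKernel

variable {X : Type*} [MeasurableSpace X] {lam : Measure X} {p : X → ℝ} {q a : X → X → ℝ}

theorem lintegral_proposal_mul_le_one (hq : IsProposalDensity lam q) (ha1 : ∀ x y, a x y ≤ 1)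
    (x : X) : ∫⁻ y, ENNReal.ofReal (q x y * a x y) ∂lam ≤ 1 := by
  rw [← hq.lintegral_eq_one x]
  exact lintegral_mono fun y => ENNReal.ofReal_le_ofReal
    (mul_le_of_le_one_right (hq.nonneg x y) (ha1 x y))

theorem IsTargetDensity.isProbabilityMeasure (hp : IsTargetDensity lam p) :
    IsProbabilityMeasure (target lam p) :=
  ⟨by rw [target, withDensity_apply _ MeasurableSet.univ, Measure.restrict_univ,
    hp.lintegral_eq_one]⟩

variable [SigmaFinite lam]

theorem isMarkovKernel_proposalKernel (hq : IsProposalDensity lam q)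
    (ha : Measurable (Function.uncurry a)) (ha1 : ∀ x y, a x y ≤ 1) :
    IsMarkovKernel (proposalKernel lam q a) := by
  refine ⟨fun x => ⟨?_⟩⟩
  rw [proposalKernel_apply lam hq.measurable ha x MeasurableSet.univ, Measure.restrict_univ,
    Set.indicator_univ, Pi.one_apply, mul_one,
    add_tsub_cancel_of_le (lintegral_proposal_mul_le_one hq ha1 x)]

/-- Detailed balance of the densities implies reversibility. -/
theorem isReversible_proposalKernel (hp : IsTargetDensity lam p) (hq : IsProposalDensity lam q)
    (ha : Measurable (Function.uncurry a))
    (hsymm : ∀ x y, p x * q x y * a x y = p y * q y x * a y x) :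
    (proposalKernel lam q a).IsReversible (target lam p) := by
  have hm : Measurable (Function.uncurry fun x y => ENNReal.ofReal (q x y * a x y)) :=
    (hq.measurable.mul ha).ennreal_ofReal
  have hpm : Measurable fun x => ENNReal.ofReal (p x) := hp.measurable.ennreal_ofReal
  have key : ∀ {A B : Set X}, MeasurableSet A → MeasurableSet B →
      ∫⁻ x in A, proposalKernel lam q a x B ∂(target lam p) =
        ∫⁻ x in A, ∫⁻ y in B, ENNReal.ofReal (p x * q x y * a x y) ∂lam ∂lam +
          ∫⁻ x in A ∩ B, (1 - ∫⁻ y, ENNReal.ofReal (q x y * a x y) ∂lam) ∂(target lam p) := by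
    intro A B hA hB
    simp only [proposalKernel_apply lam hq.measurable ha _ hB]
    have hmB : Measurable fun x => ∫⁻ y in B, ENNReal.ofReal (q x y * a x y) ∂lam :=
      hm.lintegral_prod_right
    rw [lintegral_add_left hmB]
    congr 1
    · rw [target, setLIntegral_withDensity_eq_setLIntegral_mul _ hpm hmB hA]
      refine lintegral_congr fun x => ?_
      rw [Pi.mul_apply, ← lintegral_const_mul _ (hm.of_uncurry_left (x := x))]
      refine lintegral_congr fun y => ?_
      rw [← ENNReal.ofReal_mul (hp.nonneg x), mul_assoc]
    · rw [Set.inter_comm, ← Measure.restrict_restrict hB, ← lintegral_indicator hB]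
      refine lintegral_congr fun x => ?_
      by_cases hx : x ∈ B <;> simp [hx]
  intro A B hA hB
  rw [key hA hB, key hB hA, Set.inter_comm B A, lintegral_lintegral_swap]
  · simp only [hsymm]
  · exact (((hp.measurable.comp measurable_fst).mul hq.measurable).mul
      ha).ennreal_ofReal.aemeasurable

/-- For a measurable `h` this is an equality; in general the lower integral may be smaller than
`h x`, as singletons need not be measurable. -/
theorem lintegral_dirac_le (x : X) (h : X → ℝ≥0∞) : ∫⁻ y, h y ∂(Measure.dirac x) ≤ h x := by
  obtain ⟨g, hg, hgh, hI⟩ := exists_measurable_le_lintegral_eq (Measure.dirac x) h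
  rw [hI, lintegral_dirac' x hg]
  exact hgh x

/-- Rejected moves do not contribute to the integral of a function vanishing at the current
state. -/
theorem lintegral_proposalKernel (hq : Measurable (Function.uncurry q))
    (ha : Measurable (Function.uncurry a)) {x : X} {h : X → ℝ≥0∞} (hx : h x = 0) :
    ∫⁻ y, h y ∂(proposalKernel lam q a x) =
      ∫⁻ y, h y ∂(lam.withDensity fun y => ENNReal.ofReal (q x y * a x y)) := by
  have h1 : Measurable (Function.uncurry fun x y => ENNReal.ofReal (q x y * a x y)) :=
    (hq.mul ha).ennreal_ofReal
  have h2 : Measurable (Function.uncurry fun (x : X) (_ : X) =>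
      1 - ∫⁻ y, ENNReal.ofReal (q x y * a x y) ∂lam) :=
    (measurable_const.sub h1.lintegral_prod_right).comp measurable_fst
  have h3 : ∫⁻ y, h y ∂(Measure.dirac x) = 0 := nonpos_iff_eq_zero.1 (hx ▸ lintegral_dirac_le x h)
  rw [proposalKernel, _root_.add_apply, lintegral_add_measure, Kernel.withDensity_apply _ h1,
    Kernel.withDensity_apply _ h2, Kernel.const_apply, Kernel.id_apply, withDensity_const,
    lintegral_smul_measure, h3, smul_zero, add_zero]

theorem dirichletForm_proposalKernel_mono {a' : X → X → ℝ} (hq : IsProposalDensity lam q)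
    (ha : Measurable (Function.uncurry a)) (ha' : Measurable (Function.uncurry a'))
    {s : ℝ} (hs : 0 ≤ s) (haa' : ∀ x y, s * a x y ≤ a' x y) (mu : Measure X) (f : X → ℝ) :
    ENNReal.ofReal s * dirichletForm (proposalKernel lam q a) mu f ≤
      dirichletForm (proposalKernel lam q a') mu f := by
  rw [dirichletForm, dirichletForm, mul_left_comm, ← lintegral_const_mul' _ _ ENNReal.ofReal_ne_top]
  gcongr with x
  have hx : ENNReal.ofReal ((f x - f x) ^ 2) = 0 := by simp
  rw [lintegral_proposalKernel (h := fun y => ENNReal.ofReal ((f x - f y) ^ 2)) hq.measurable ha hx,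
    lintegral_proposalKernel (h := fun y => ENNReal.ofReal ((f x - f y) ^ 2)) hq.measurable ha' hx,
    ← smul_eq_mul, ← lintegral_smul_measure, ← withDensity_smul' _ _ ENNReal.ofReal_ne_top]
  refine lintegral_mono' (withDensity_mono (ae_of_all _ fun y => ?_)) le_rfl
  rw [Pi.smul_apply, smul_eq_mul, ← ENNReal.ofReal_mul hs]
  refine ENNReal.ofReal_le_ofReal ?_
  rw [mul_left_comm]
  exact mul_le_mul_of_nonneg_left (haa' x y) (hq.nonneg x y)

theorem spectralGap_mono {K K' : Kernel X X} {mu : Measure X} {s : ℝ≥0∞}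
    (h : ∀ f, IsCenteredL2 mu f → s * dirichletForm K mu f ≤ dirichletForm K' mu f) :
    s * spectralGap K mu ≤ spectralGap K' mu := by
  refine le_iInf fun f => le_iInf fun hf => le_iInf fun hf0 => ?_
  calc s * spectralGap K mu ≤ s * (dirichletForm K mu f / sqNorm mu f) := by
        gcongr
        exact iInf_le_of_le f (iInf_le_of_le hf (iInf_le _ hf0))
    _ = s * dirichletForm K mu f / sqNorm mu f := (mul_div_assoc _ _ _).symm
    _ ≤ dirichletForm K' mu f / sqNorm mu f := by gcongr; exact h f hf

end ProposalKernel

/-! ### Acceptance probabilities -/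

section Acceptance

variable {X : Type*} {p : X → ℝ} {q : X → X → ℝ}

theorem measurable_ratio [MeasurableSpace X] (hp : Measurable p)
    (hq : Measurable (Function.uncurry q)) :
    Measurable (Function.uncurry (ratio p q)) :=
  ((hp.comp measurable_snd).mul (hq.comp measurable_swap)).div
    ((hp.comp measurable_fst).mul hq)

theorem measurable_mhAccept [MeasurableSpace X] (hp : Measurable p)
    (hq : Measurable (Function.uncurry q)) :
    Measurable (Function.uncurry (mhAccept p q)) :=
  measurable_const.min (measurable_ratio hp hq)

theorem measurable_daAccept [MeasurableSpace X] {d : ℕ} {rho : Fin d → X → X → ℝ}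
    (hrho : ∀ k, Measurable (Function.uncurry (rho k))) :
    Measurable (Function.uncurry (daAccept rho)) := by
  have h : Function.uncurry (daAccept rho) =
      fun z => ∏ k, min 1 (Function.uncurry (rho k) z) := rfl
  rw [h]
  exact Finset.measurable_prod _ fun k _ => measurable_const.min (hrho k)

theorem ratio_nonneg (hp : ∀ x, 0 ≤ p x) (hq : ∀ x y, 0 ≤ q x y) (x y : X) :
    0 ≤ ratio p q x y :=
  div_nonneg (mul_nonneg (hp y) (hq y x)) (mul_nonneg (hp x) (hq x y))

theorem ratio_eq_zero {x y : X} (h : p x * q x y = 0 ∨ p y * q y x = 0) : ratio p q x y = 0 := by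
  rcases h with h | h <;> simp [ratio, h]

/-- An acceptance probability satisfies detailed balance as soon as it vanishes with the ratio
`r` and `a(x, y) = r(x, y) a(y, x)` where `r` is positive. -/
theorem detailedBalance_of_ratio (hp : ∀ x, 0 ≤ p x) (hq : ∀ x y, 0 ≤ q x y) {a : X → X → ℝ}
    (h0 : ∀ x y, ratio p q x y = 0 → a x y = 0)
    (h1 : ∀ x y, 0 < p x * q x y → 0 < p y * q y x → a x y = ratio p q x y * a y x) (x y : X) :
    p x * q x y * a x y = p y * q y x * a y x := by
  rcases (mul_nonneg (hp x) (hq x y)).eq_or_lt with hx | hx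
  · rw [← hx, h0 y x (ratio_eq_zero (Or.inr hx.symm)), zero_mul, mul_zero]
  rcases (mul_nonneg (hp y) (hq y x)).eq_or_lt with hy | hy
  · rw [← hy, h0 x y (ratio_eq_zero (Or.inr hy.symm)), zero_mul, mul_zero]
  rw [h1 x y hx hy, ← mul_assoc, ratio, mul_div_cancel₀ _ hx.ne']

theorem min_one_eq_mul_min_one_inv {t : ℝ} (ht : 0 < t) : min 1 t = t * min 1 t⁻¹ := by
  rw [mul_min_of_nonneg _ _ ht.le, mul_one, mul_inv_cancel₀ ht.ne', min_comm]

theorem mhAccept_balance (hp : ∀ x, 0 ≤ p x) (hq : ∀ x y, 0 ≤ q x y) (x y : X) :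
    p x * q x y * mhAccept p q x y = p y * q y x * mhAccept p q y x := by
  refine detailedBalance_of_ratio hp hq (fun x y h => ?_) (fun x y hx hy => ?_) x y
  · simp [mhAccept, h]
  · have h : ratio p q y x = (ratio p q x y)⁻¹ := (inv_div _ _).symm
    rw [mhAccept, mhAccept, h]
    exact min_one_eq_mul_min_one_inv (div_pos hy hx)

theorem daAccept_balance [MeasurableSpace X] (hp : ∀ x, 0 ≤ p x) (hq : ∀ x y, 0 ≤ q x y) {d : ℕ}
    {rho : Fin d → X → X → ℝ} (hrho : IsBalancedFactorisation p q rho)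
    (h0 : ∀ x y, ratio p q x y = 0 → ∃ k, rho k x y = 0) (x y : X) :
    p x * q x y * daAccept rho x y = p y * q y x * daAccept rho y x := by
  refine detailedBalance_of_ratio hp hq (fun x y h => ?_) (fun x y hx hy => ?_) x y
  · obtain ⟨k, hk⟩ := h0 x y h
    exact Finset.prod_eq_zero (Finset.mem_univ k) (by simp [hk])
  · rw [daAccept, daAccept, hrho.prod_eq x y hx hy, ← Finset.prod_mul_distrib]
    refine Finset.prod_congr rfl fun k _ => ?_
    rw [hrho.balance k y x hy hx]
    exact min_one_eq_mul_min_one_inv (hrho.pos k x y hx hy)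

/-! ### Clipped factors -/

theorem threshold_pos {c : ℝ} (hc0 : 0 < c) (d : ℕ) : 0 < threshold c d :=
  Real.rpow_pos_of_pos hc0 _

theorem threshold_le_one {c : ℝ} (hc0 : 0 < c) (hc1 : c ≤ 1) (n : ℕ) :
    threshold c (n + 1) ≤ 1 :=
  Real.rpow_le_one hc0.le hc1 (by simp)

theorem threshold_pow {c : ℝ} (hc0 : 0 < c) {n : ℕ} (hn : n ≠ 0) :
    threshold c (n + 1) ^ n = c := by
  rw [threshold, Nat.cast_add_one, add_sub_cancel_right, one_div,
    Real.rpow_inv_natCast_pow hc0.le hn]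

theorem le_clip {b : ℝ} (hb0 : 0 < b) (hb1 : b ≤ 1) (t : ℝ) : b ≤ clip b t :=
  le_min (hb1.trans (one_le_one_div hb0 hb1)) (le_max_left _ _)

theorem clip_le (b t : ℝ) : clip b t ≤ 1 / b := min_le_left _ _

theorem clip_inv {b t : ℝ} (hb0 : 0 < b) (hb1 : b ≤ 1) (ht : 0 < t) :
    clip b t⁻¹ = (clip b t)⁻¹ := by
  have hbb : b ≤ b⁻¹ := hb1.trans ((one_le_inv₀ hb0).2 hb1)
  rw [clip, clip, one_div]
  rcases le_total t b with h | h
  · have h1 : b⁻¹ ≤ t⁻¹ := (inv_le_inv₀ hb0 ht).2 h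
    rw [max_eq_left h, min_eq_right hbb, max_eq_right (hbb.trans h1), min_eq_left h1]
  · have h1 : t⁻¹ ≤ b⁻¹ := (inv_le_inv₀ ht hb0).2 h
    rw [max_eq_right h, min_eq_right (max_le hbb h1)]
    rcases le_total t b⁻¹ with h2 | h2
    · rw [min_eq_right h2, max_eq_right ((le_inv_comm₀ hb0 ht).2 h2)]
    · rw [min_eq_left h2, inv_inv, max_eq_left ((inv_le_comm₀ ht hb0).2 h2)]

variable {c : ℝ} {n : ℕ} {rho : Fin (n + 1) → X → X → ℝ}

theorem modifiedFactor_castSucc (i : Fin n) (x y : X) :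
    modifiedFactor p q c rho i.castSucc x y = clip (threshold c (n + 1)) (rho i.castSucc x y) := by
  simp [modifiedFactor]

theorem modifiedFactor_last (x y : X) :
    modifiedFactor p q c rho (Fin.last n) x y =
      ratio p q x y / ∏ i : Fin n, clip (threshold c (n + 1)) (rho i.castSucc x y) := by
  simp [modifiedFactor, Finset.prod_filter, Fin.prod_univ_castSucc]

theorem prod_clip_pos (hc0 : 0 < c) (hc1 : c ≤ 1) (x y : X) :
    0 < ∏ i : Fin n, clip (threshold c (n + 1)) (rho i.castSucc x y) :=
  Finset.prod_pos fun _ _ =>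
    (threshold_pos hc0 _).trans_le (le_clip (threshold_pos hc0 _) (threshold_le_one hc0 hc1 n) _)

/-- Clipping preserves the balance condition, and the last factor restores the product. -/
theorem isBalancedFactorisation_modifiedFactor [MeasurableSpace X] (hp : Measurable p)
    (hq : Measurable (Function.uncurry q)) (hrho : IsBalancedFactorisation p q rho)
    (hc0 : 0 < c) (hc1 : c ≤ 1) : IsBalancedFactorisation p q (modifiedFactor p q c rho) where
  measurable k := by
    have hclip : ∀ j, Measurable fun z : X × X =>
        clip (threshold c (n + 1)) (Function.uncurry (rho j) z) := fun j =>
      measurable_const.min (measurable_const.max (hrho.measurable j))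
    refine k.lastCases ?_ fun i => ?_
    · have h : Function.uncurry (modifiedFactor p q c rho (Fin.last n)) = fun z =>
          Function.uncurry (ratio p q) z / ∏ i : Fin n,
            clip (threshold c (n + 1)) (Function.uncurry (rho i.castSucc) z) :=
        funext fun z => modifiedFactor_last z.1 z.2
      rw [h]
      exact (measurable_ratio hp hq).div (Finset.measurable_prod _ fun i _ => hclip _)
    · have h : Function.uncurry (modifiedFactor p q c rho i.castSucc) = fun z =>
            clip (threshold c (n + 1)) (Function.uncurry (rho i.castSucc) z) :=
        funext fun z => modifiedFactor_castSucc i z.1 z.2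
      rw [h]
      exact hclip _
  pos k x y hx hy := by
    refine k.lastCases ?_ fun i => ?_
    · rw [modifiedFactor_last]
      exact div_pos (div_pos hy hx) (prod_clip_pos hc0 hc1 x y)
    · rw [modifiedFactor_castSucc]
      exact (threshold_pos hc0 _).trans_le
        (le_clip (threshold_pos hc0 _) (threshold_le_one hc0 hc1 n) _)
  balance k x y hx hy := by
    have hclip : ∀ i : Fin n, clip (threshold c (n + 1)) (rho i.castSucc x y) =
        (clip (threshold c (n + 1)) (rho i.castSucc y x))⁻¹ := fun i => by
      rw [hrho.balance _ x y hx hy]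
      exact clip_inv (threshold_pos hc0 _) (threshold_le_one hc0 hc1 n) (hrho.pos _ y x hy hx)
    refine k.lastCases ?_ fun i => ?_
    · rw [modifiedFactor_last, modifiedFactor_last, inv_div,
        Finset.prod_congr rfl fun i _ => hclip i, Finset.prod_inv_distrib, ratio, ratio,
        ← inv_div (p x * q x y), div_inv_eq_mul, inv_mul_eq_div]
    · rw [modifiedFactor_castSucc, modifiedFactor_castSucc, hclip]
  prod_eq x y _ _ := by
    rw [Fin.prod_univ_castSucc, modifiedFactor_last]
    simp only [modifiedFactor_castSucc]
    rw [mul_div_cancel₀ _ (prod_clip_pos hc0 hc1 x y).ne']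

theorem modifiedFactor_nonneg (hp : ∀ x, 0 ≤ p x) (hq : ∀ x y, 0 ≤ q x y)
    (hc0 : 0 < c) (hc1 : c ≤ 1) (k : Fin (n + 1)) (x y : X) :
    0 ≤ modifiedFactor p q c rho k x y := by
  refine k.lastCases ?_ fun i => ?_
  · rw [modifiedFactor_last]
    exact div_nonneg (ratio_nonneg hp hq x y) (prod_clip_pos hc0 hc1 x y).le
  · rw [modifiedFactor_castSucc]
    exact (threshold_pos hc0 _).le.trans
      (le_clip (threshold_pos hc0 _) (threshold_le_one hc0 hc1 n) _)

theorem daAccept_le_one {d : ℕ} {rho : Fin d → X → X → ℝ} {x y : X} (h : ∀ k, 0 ≤ rho k x y) :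
    daAccept rho x y ≤ 1 :=
  Finset.prod_le_one (fun k _ => le_min zero_le_one (h k)) fun _ _ => min_le_left _ _

/-- One factor `c = bⁿ` bounds the clipped stages from below, and the product of the clipped factors
being at most `c⁻¹` costs another one at the last stage. -/
theorem sq_mul_mhAccept_le_daAccept (hp : ∀ x, 0 ≤ p x) (hq : ∀ x y, 0 ≤ q x y)
    (hc0 : 0 < c) (hc1 : c ≤ 1) (hn : n ≠ 0) (x y : X) :
    c ^ 2 * mhAccept p q x y ≤ daAccept (modifiedFactor p q c rho) x y := by
  set b := threshold c (n + 1) with hb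
  have hb0 : 0 < b := threshold_pos hc0 _
  have hb1 : b ≤ 1 := threshold_le_one hc0 hc1 n
  have hbn : b ^ n = c := threshold_pow hc0 hn
  have hr := ratio_nonneg hp hq x y
  rw [daAccept, Fin.prod_univ_castSucc, modifiedFactor_last, mhAccept, sq, mul_assoc]
  simp only [modifiedFactor_castSucc]
  rw [← hb]
  have h1 : c ≤ ∏ i : Fin n, min 1 (clip b (rho i.castSucc x y)) := by
    calc c = ∏ _i : Fin n, b := by simp [hbn]
      _ ≤ _ := Finset.prod_le_prod (fun _ _ => hb0.le)
        fun i _ => le_min hb1 (le_clip hb0 hb1 _)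
  have h2 : ∏ i : Fin n, clip b (rho i.castSucc x y) ≤ c⁻¹ := by
    calc ∏ i : Fin n, clip b (rho i.castSucc x y) ≤ ∏ _i : Fin n, 1 / b :=
          Finset.prod_le_prod (fun _ _ => hb0.le.trans (le_clip hb0 hb1 _)) fun _ _ => clip_le _ _
      _ = c⁻¹ := by simp [hbn]
  have h3 : c * min 1 (ratio p q x y) ≤
      min 1 (ratio p q x y / ∏ i : Fin n, clip b (rho i.castSucc x y)) := by
    refine le_min ((mul_le_of_le_one_right hc0.le (min_le_left 1 (ratio p q x y))).trans hc1) ?_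
    rw [le_div_iff₀ (prod_clip_pos hc0 hc1 x y)]
    calc c * min 1 (ratio p q x y) * ∏ i : Fin n, clip b (rho i.castSucc x y)
        ≤ c * ratio p q x y * c⁻¹ :=
          mul_le_mul (mul_le_mul_of_nonneg_left (min_le_right _ _) hc0.le) h2
            (prod_clip_pos hc0 hc1 x y).le (mul_nonneg hc0.le hr)
      _ = ratio p q x y := by field_simp
  exact mul_le_mul h1 h3 (mul_nonneg hc0.le (le_min zero_le_one hr)) (hc0.le.trans h1)

end Acceptance

/-! ### Dirichlet forms and asymptotic variances -/

/-- Ordering of Dirichlet forms implies the comparison of asymptotic variances. -/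
theorem exists_asymptoticVariance_le {X : Type*} [MeasurableSpace X] {mu : Measure X}
    [IsProbabilityMeasure mu] {K K' : Kernel X X} [IsMarkovKernel K] [IsMarkovKernel K']
    (hK : K.IsReversible mu) (hK' : K'.IsReversible mu) {s : ℝ} (hs0 : 0 < s) (hs1 : s ≤ 1)
    (h : ∀ f, ENNReal.ofReal s * dirichletForm K mu f ≤ dirichletForm K' mu f)
    {f : X → ℝ} (hf : IsCenteredL2 mu f) :
    ∃ v v' : ℝ≥0∞, HasAsymptoticVariance K mu f v ∧ HasAsymptoticVariance K' mu f v' ∧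
      v' ≤ ENNReal.ofReal (s⁻¹ - 1) * evariance f mu + ENNReal.ofReal s⁻¹ * v := by
  refine ⟨_, _, hasAsymptoticVariance_operatorVariance hK hf.1 hf.2,
    hasAsymptoticVariance_operatorVariance hK' hf.1 hf.2, ?_⟩
  rw [evariance_eq_of_integral_eq_zero hf.1 hf.2]
  refine operatorVariance_le (isSymmContraction_transitionOp hK)
    (isSymmContraction_transitionOp hK') hs0 hs1 (fun g => ?_) _
  have hg := h g
  rwa [dirichletForm_eq hK.invariant, dirichletForm_eq hK'.invariant, ← ENNReal.ofReal_mul hs0.le,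
    ENNReal.ofReal_le_ofReal_iff
      ((isSymmContraction_transitionOp hK').inner_self_sub_nonneg g)] at hg

end DelayedAcceptance

end

open DelayedAcceptance in
theorem mainTheorem3 {X : Type*} [MeasurableSpace X] (lam : Measure X) [SigmaFinite lam]
    (p : X → ℝ) (hp : DelayedAcceptance.IsTargetDensity lam p)
    (q : X → X → ℝ) (hq : DelayedAcceptance.IsProposalDensity lam q)
    (d : ℕ) (hd : 2 ≤ d) (rho : Fin d → X → X → ℝ)
    (hrho : DelayedAcceptance.IsBalancedFactorisation p q rho)
    (c : ℝ) (hc0 : 0 < c) (hc1 : c ≤ 1)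
    (mu : Measure X) (hmu : mu = DelayedAcceptance.target lam p)
    (P : Kernel X X) (hP : P = DelayedAcceptance.mhKernel lam p q)
    (Pda : Kernel X X)
    (hPda : Pda = DelayedAcceptance.daKernel lam q
      (DelayedAcceptance.modifiedFactor p q c rho)) :
    ∃ (_ : IsMarkovKernel P) (_ : IsMarkovKernel Pda),
      P.IsReversible mu ∧ Pda.IsReversible mu ∧
      (∀ f : X → ℝ, DelayedAcceptance.IsCenteredL2 mu f →
        ENNReal.ofReal (c ^ 2) * DelayedAcceptance.dirichletForm P mu f ≤
          DelayedAcceptance.dirichletForm Pda mu f) ∧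
      ENNReal.ofReal (c ^ 2) * DelayedAcceptance.spectralGap P mu ≤
        DelayedAcceptance.spectralGap Pda mu ∧
      (∀ f : X → ℝ, DelayedAcceptance.IsCenteredL2 mu f →
        ∃ v vda : ℝ≥0∞,
          DelayedAcceptance.HasAsymptoticVariance P mu f v ∧
          DelayedAcceptance.HasAsymptoticVariance Pda mu f vda ∧
          vda ≤ ENNReal.ofReal ((c ^ 2)⁻¹ - 1) * evariance f mu +
            ENNReal.ofReal (c ^ 2)⁻¹ * v) := by
  have hprob : IsProbabilityMeasure mu := hmu ▸ hp.isProbabilityMeasure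
  obtain ⟨n, rfl⟩ : ∃ n, d = n + 1 := ⟨d - 1, by omega⟩
  have hn : n ≠ 0 := by omega
  have hbal := isBalancedFactorisation_modifiedFactor hp.measurable hq.measurable hrho hc0 hc1
  have hmA := measurable_mhAccept hp.measurable hq.measurable
  have hmD := measurable_daAccept hbal.measurable
  have hPM : IsMarkovKernel P := hP ▸ isMarkovKernel_proposalKernel hq hmA
    fun _ _ => min_le_left _ _
  have hDM : IsMarkovKernel Pda := hPda ▸ isMarkovKernel_proposalKernel hq hmD
    fun x y => daAccept_le_one fun k => modifiedFactor_nonneg hp.nonneg hq.nonneg hc0 hc1 k x y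
  have hPR : P.IsReversible mu := by
    rw [hP, hmu]
    exact isReversible_proposalKernel hp hq hmA (mhAccept_balance hp.nonneg hq.nonneg)
  have hDR : Pda.IsReversible mu := by
    rw [hPda, hmu]
    refine isReversible_proposalKernel hp hq hmD
      (daAccept_balance hp.nonneg hq.nonneg hbal fun x y h => ⟨Fin.last n, ?_⟩)
    rw [modifiedFactor_last, h, zero_div]
  have hE : ∀ f : X → ℝ,
      ENNReal.ofReal (c ^ 2) * dirichletForm P mu f ≤ dirichletForm Pda mu f := fun f => by
    rw [hP, hPda]
    exact dirichletForm_proposalKernel_mono hq hmA hmD (sq_nonneg c)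
      (sq_mul_mhAccept_le_daAccept hp.nonneg hq.nonneg hc0 hc1 hn) mu f
  exact ⟨hPM, hDM, hPR, hDR, fun f _ => hE f, spectralGap_mono fun f _ => hE f,
    fun f hf => exists_asymptoticVariance_le hPR hDR (by positivity) (pow_le_one₀ hc0.le hc1) hE hf⟩
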